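/- Let $\Gamma$ be an $n$-space group, that is, a discrete group of isometries of Euclidean $n$-space $E^n$ with compact orbit space $E^n/\Gamma$. Each $\gamma\in\Gamma$ has the form $\gamma = b+B$, meaning $\gamma(x)=b+Bx$, with $b\in E^n$ and $B$ an orthogonal transformation of $E^n$. Let $\mathrm N$ be a normal subgroup of $\Gamma$ such that $\Gamma/\mathrm N$ is infinite cyclic. Let $V=\mathrm{Span}(\mathrm N)$ be the linear span of all $a\in E^n$ such that the translation $x\mapsto a+x$ belongs to $\mathrm N$, and let $V^\perp$ be its orthogonal complement. The group $\Gamma$ acts on $V$ by $\gamma v=\overline b+Bv$ and on $V^\perp$ by $\gamma w=b'+Bw$, where $\gamma=b+B$ and $b=\overline b+b'$ with $\overline b\in V$, $b'\in V^\perp$. Let $\mathrm K$ be the kernel of the action of $\Gamma$ on $V$, and suppose that the structure group $\Gamma/\mathrm{NK}$ is finite of order $m$. Then $V^\perp/\mathrm K$, with the orbit space distance, is a circle, and $\Gamma/\mathrm{NK}$ acts on it by $(\gamma\mathrm{NK})(\mathrm Kw)=\mathrm K(\gamma w)$. If $\gamma\in\Gamma$ is such that $\gamma\mathrm{NK}$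 generates $\Gamma/\mathrm{NK}$, then there exists $\delta\in\Gamma$ such that $\gamma\mathrm{NK}=\delta\mathrm{NK}$ and $\delta\mathrm N$ generates $\Gamma/\mathrm N$ if and only if $\gamma\mathrm{NK}$ acts on the circle $V^\perp/\mathrm K$ by a rotation of $\pm 2\pi/m$. -/

import Mathlib

noncomputable section

/-- Euclidean `n`-space. -/
abbrev EucSpace (n : ℕ) : Type := EuclideanSpace ℝ (Fin n)

/-- The group of isometries `x ↦ b + B x` (`B` orthogonal) of Euclidean `n`-space.
For `g : EucIsom n`, `b` is `g 0` and `B` is `g.linearIsometryEquiv`. -/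
abbrev EucIsom (n : ℕ) : Type := EucSpace n ≃ᵃⁱ[ℝ] EucSpace n

instance EucIsom.mulAction (n : ℕ) : MulAction (EucIsom n) (EucSpace n) where
  smul g x := g x
  one_smul _ := rfl
  mul_smul _ _ _ := rfl

theorem EucIsom.apply_eq {n : ℕ} (g : EucIsom n) (x : EucSpace n) :
    g x = g.linearIsometryEquiv x + g 0 := by
  simpa using g.map_vadd 0 x

theorem EucIsom.apply_add {n : ℕ} (g : EucIsom n) (x y : EucSpace n) :
    g (x + y) = g.linearIsometryEquiv x + g y := by
  simpa using g.map_vadd y x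

/-- An isometry viewed as a continuous map; `C(E, E)` carries the compact-open topology. -/
def EucIsom.toContinuousMap {n : ℕ} (g : EucIsom n) : C(EucSpace n, EucSpace n) :=
  ⟨g, g.continuous⟩

/-- An `n`-dimensional crystallographic group (`n`-space group): a discrete group of isometries
of Euclidean `n`-space with compact orbit space. -/
structure IsSpaceGroup {n : ℕ} (Γ : Subgroup (EucIsom n)) : Prop where
  discrete : IsDiscrete (EucIsom.toContinuousMap '' (Γ : Set (EucIsom n)))
  cocompact : CompactSpace (Quotient (MulAction.orbitRel Γ (EucSpace n)))

/-- `Span(N)`: the linear span of all `a` such that the translation `a + I` lies in `N`. -/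
def spanOf {n : ℕ} {Γ : Subgroup (EucIsom n)} (N : Subgroup Γ) : Submodule ℝ (EucSpace n) :=
  Submodule.span ℝ {a | ∃ g ∈ N, ∀ x, (g : EucIsom n) x = a + x}

section Actions

variable {n : ℕ} {Γ : Subgroup (EucIsom n)}

/-- If `b + B ∈ Γ` and `N` is normal in `Γ`, then `B` maps `V = Span(N)` into itself. -/
theorem linear_mem_spanOf (N : Subgroup Γ) [hN : N.Normal] (g : Γ) {v : EucSpace n}
    (hv : v ∈ spanOf N) : (g : EucIsom n).linearIsometryEquiv v ∈ spanOf N := by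
  unfold spanOf at hv
  induction hv using Submodule.span_induction with
  | mem a ha =>
    obtain ⟨h, hh, hx⟩ := ha
    refine Submodule.subset_span ⟨g * h * g⁻¹, hN.conj_mem h hh g, fun x => ?_⟩
    have h1 : ((g * h * g⁻¹ : Γ) : EucIsom n) x
        = (g : EucIsom n) ((h : EucIsom n) (((g : EucIsom n)⁻¹ : EucIsom n) x)) := rfl
    rw [h1, hx, EucIsom.apply_add]
    congr 1
    exact (g : EucIsom n).apply_symm_apply x
  | zero => simp
  | add x y _ _ hx hy => rw [map_add]; exact add_mem hx hy
  | smul c x _ hx => rw [map_smul]; exact Submodule.smul_mem _ c hx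

/-- If `b + B ∈ Γ` and `N` is normal in `Γ`, then `B` maps `V^⊥` into itself. -/
theorem linear_mem_perp (N : Subgroup Γ) [N.Normal] (g : Γ) {w : EucSpace n}
    (hw : w ∈ (spanOf N)ᗮ) : (g : EucIsom n).linearIsometryEquiv w ∈ (spanOf N)ᗮ := by
  rw [Submodule.mem_orthogonal] at hw ⊢
  intro u hu
  have h1 := hw _ (linear_mem_spanOf N g⁻¹ hu)
  have h2 : (g : EucIsom n).linearIsometryEquiv
      (((g⁻¹ : Γ) : EucIsom n).linearIsometryEquiv u) = u :=
    (g : EucIsom n).linearIsometryEquiv.apply_symm_apply u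
  rw [← h2, LinearIsometryEquiv.inner_map_map]
  exact h1

/-- Let `W` be a subspace such that the linear parts of the elements of `Γ` leave `W^⊥` invariant.
Then `Γ` acts on `W`: the element `b + B` maps `w` to the orthogonal projection of `b + B w`. -/
@[reducible] def projAction (Γ : Subgroup (EucIsom n)) (W : Submodule ℝ (EucSpace n))
    (hW : ∀ (g : Γ), ∀ x ∈ Wᗮ, (g : EucIsom n).linearIsometryEquiv x ∈ Wᗮ) : MulAction Γ W where
  smul g w := W.orthogonalProjectionOnto ((g : EucIsom n) (w : EucSpace n))
  one_smul w := by
    change W.orthogonalProjectionOnto (w : EucSpace n) = w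
    simp
  mul_smul g h w := by
    change W.orthogonalProjectionOnto ((g : EucIsom n) ((h : EucIsom n) (w : EucSpace n)))
      = W.orthogonalProjectionOnto ((g : EucIsom n)
          (W.orthogonalProjectionOnto ((h : EucIsom n) (w : EucSpace n)) : EucSpace n))
    set y := (h : EucIsom n) (w : EucSpace n)
    have hy : y - (W.orthogonalProjectionOnto y : EucSpace n) ∈ Wᗮ :=
      Submodule.sub_starProjection_mem_orthogonal (K := W) y
    have h1 : (g : EucIsom n) y = (g : EucIsom n).linearIsometryEquiv
        (y - (W.orthogonalProjectionOnto y : EucSpace n))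
          + (g : EucIsom n) (W.orthogonalProjectionOnto y : EucSpace n) := by
      rw [← EucIsom.apply_add, sub_add_cancel]
    rw [h1, map_add, Submodule.orthogonalProjectionOnto_eq_zero_iff.2 (hW g _ hy), zero_add]

/-- The action of `Γ` on `V = Span(N)`: if `γ = b + B` and `b = b₁ + b₂` with `b₁ ∈ V` and
`b₂ ∈ V^⊥`, then `γ` maps `v` to `b₁ + B v`. -/
instance spanAction (N : Subgroup Γ) [N.Normal] : MulAction Γ (spanOf N) :=
  projAction Γ (spanOf N) fun g _ hx => linear_mem_perp N g hx

/-- The action of `Γ` on `V^⊥`: if `γ = b + B` and `b = b₁ + b₂` with `b₁ ∈ V` and `b₂ ∈ V^⊥`,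
then `γ` maps `w` to `b₂ + B w`. -/
instance perpAction (N : Subgroup Γ) [N.Normal] : MulAction Γ (spanOf N)ᗮ :=
  projAction Γ (spanOf N)ᗮ fun g x hx => by
    rw [Submodule.orthogonal_orthogonal] at hx ⊢
    exact linear_mem_spanOf N g hx

theorem spanAction_coe (N : Subgroup Γ) [N.Normal] (g : Γ) (v : spanOf N) :
    ((g • v : spanOf N) : EucSpace n)
      = (g : EucIsom n).linearIsometryEquiv v
        + (spanOf N).orthogonalProjectionOnto ((g : EucIsom n) 0) := by
  change (((spanOf N).orthogonalProjectionOnto ((g : EucIsom n) (v : EucSpace n)) : spanOf N) :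
    EucSpace n) = _
  rw [EucIsom.apply_eq, map_add, Submodule.coe_add]
  congr 1
  exact Submodule.starProjection_eq_self_iff.2 (linear_mem_spanOf N g v.2)

theorem perpAction_coe (N : Subgroup Γ) [N.Normal] (g : Γ) (w : ((spanOf N)ᗮ : Submodule ℝ _)) :
    ((g • w : ((spanOf N)ᗮ : Submodule ℝ _)) : EucSpace n)
      = (g : EucIsom n).linearIsometryEquiv w
        + (spanOf N)ᗮ.orthogonalProjectionOnto ((g : EucIsom n) 0) := by
  change (((spanOf N)ᗮ.orthogonalProjectionOnto ((g : EucIsom n) (w : EucSpace n)) :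
    ((spanOf N)ᗮ : Submodule ℝ _)) : EucSpace n) = _
  rw [EucIsom.apply_eq, map_add, Submodule.coe_add]
  congr 1
  exact Submodule.starProjection_eq_self_iff.2 (linear_mem_perp N g w.2)

/-- `K`: the kernel of the action of `Γ` on `V = Span(N)`. -/
def kernelOf (N : Subgroup Γ) [N.Normal] : Subgroup Γ :=
  (MulAction.toPermHom Γ (spanOf N)).ker

instance kernelOf_normal (N : Subgroup Γ) [N.Normal] : (kernelOf N).Normal := by
  unfold kernelOf; infer_instance

/-- `K = {b + B ∈ Γ : b ∈ V^⊥ and V ⊆ Fix(B)}`. -/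
theorem mem_kernelOf_iff (N : Subgroup Γ) [N.Normal] (g : Γ) :
    g ∈ kernelOf N ↔ (g : EucIsom n) 0 ∈ (spanOf N)ᗮ ∧
      ∀ v ∈ spanOf N, (g : EucIsom n).linearIsometryEquiv v = v := by
  have h0 : g ∈ kernelOf N ↔ ∀ v : spanOf N, g • v = v := by
    simp [kernelOf, MonoidHom.mem_ker, Equiv.ext_iff]
  rw [h0]
  constructor
  · intro h
    have hz : (spanOf N).orthogonalProjectionOnto ((g : EucIsom n) 0) = 0 := by
      have := spanAction_coe N g 0
      rw [h 0] at this
      apply Subtype.ext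
      simpa [eq_comm] using this
    refine ⟨Submodule.orthogonalProjectionOnto_eq_zero_iff.1 hz, fun v hv => ?_⟩
    have := spanAction_coe N g ⟨v, hv⟩
    rw [h, hz] at this
    simpa [eq_comm] using this
  · rintro ⟨h1, h2⟩ v
    apply Subtype.ext
    rw [spanAction_coe, Submodule.orthogonalProjectionOnto_eq_zero_iff.2 h1, h2 v v.2]
    simp

/-- The orbit space `V^⊥/K`. -/
abbrev PerpOrbitSpace (N : Subgroup Γ) [N.Normal] : Type :=
  MulAction.orbitRel.Quotient (kernelOf N) ((spanOf N)ᗮ : Submodule ℝ (EucSpace n))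

/-- The orbit `K w` as a point of `V^⊥/K`. -/
def perpOrbit (N : Subgroup Γ) [N.Normal] (w : ((spanOf N)ᗮ : Submodule ℝ (EucSpace n))) :
    PerpOrbitSpace N :=
  Quotient.mk (MulAction.orbitRel (kernelOf N) _) w

/-- The orbit space distance on `V^⊥/K`: the distance between two orbits as subsets of `V^⊥`. -/
def perpOrbitDist (N : Subgroup Γ) [N.Normal] (p q : PerpOrbitSpace N) : ℝ :=
  sInf {r | ∃ x y : ((spanOf N)ᗮ : Submodule ℝ (EucSpace n)),
    perpOrbit N x = p ∧ perpOrbit N y = q ∧ r = dist x y}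

/-- A similarity of `V^⊥/K`, with its orbit space distance, onto the circle `ℝ/2πℤ`, with its
arc length distance, that is, an angular coordinate on the circle `V^⊥/K`. -/
def IsAngularCoordinate (N : Subgroup Γ) [N.Normal] (φ : PerpOrbitSpace N ≃ Real.Angle) : Prop :=
  ∃ c : ℝ, 0 < c ∧ ∀ p q, perpOrbitDist N p q = c * dist (φ p) (φ q)

/-- `V^⊥/K` is a circle. -/
def PerpOrbitSpaceIsCircle (N : Subgroup Γ) [N.Normal] : Prop :=
  ∃ φ : PerpOrbitSpace N ≃ Real.Angle, IsAngularCoordinate N φ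

/-- The map `f` is a rotation of the circle `V^⊥/K` by the angle `θ` (for one of the two
orientations of the circle). -/
def IsRotationBy (N : Subgroup Γ) [N.Normal] (f : PerpOrbitSpace N → PerpOrbitSpace N)
    (θ : ℝ) : Prop :=
  ∃ φ : PerpOrbitSpace N ≃ Real.Angle, IsAngularCoordinate N φ ∧
    ∀ p, φ (f p) = φ p + (θ : Real.Angle)

/-- The structure group `Γ/NK`. -/
abbrev StructureGroup (N : Subgroup Γ) [N.Normal] : Type := Γ ⧸ (N ⊔ kernelOf N)

/-- `ρ` is the action of the structure group `Γ/NK` on `V^⊥/K` given by `(γNK)(K w) = K (γ w)`,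
where `γ w` refers to the action of `Γ` on `V^⊥`. -/
def IsStructureAction (N : Subgroup Γ) [N.Normal]
    (ρ : StructureGroup N →* Equiv.Perm (PerpOrbitSpace N)) : Prop :=
  ∀ (g : Γ) (w : ((spanOf N)ᗮ : Submodule ℝ (EucSpace n))),
    ρ (QuotientGroup.mk g) (perpOrbit N w) = perpOrbit N (g • w)

end Actions

end

/-! Choose a surjection `χ : Γ → ℤ` with kernel `N`. The geometric heart is that `V^⊥` is a line `ℝ
c` on which every `g` acts as `w ↦ w + χ(g) c` (`exists_hom_int_perpAction_eq`). The rest is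
arithmetic modulo `m`. Since `NK` has index `m`, `χ(K) = mℤ`, so `V^⊥/K` is `ℝ c / mℤ c`, a circle
of length `m‖c‖`, and `γ` rotates it by `χ(γ) · 2π/m`. Cosets of `NK` are classes of `χ` modulo `m`,
and `δN` generates `Γ/N` iff `χ(δ) = ±1`. So `δ` exists iff `χ(γ) ≡ ±1` mod `m`, iff the rotation is
by `±2π/m`; here the metric determines the angle up to sign (`IsRotationBy.norm_eq`).

The line comes from Bieberbach's first theorem: the translations of `Γ` span `E^n`, and every
element has a power that is a translation. If all translation vectors lay in `V`, then `V = E^n`,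
`K` would be trivial and `Γ/N = Γ/NK` finite. So some translation `t` leaves `V`, and as `Γ/N` is
cyclic, one such `t` already spans `E^n` together with `V`. Each element then translates or reflects
the line; comparison with `t` excludes reflections, first for `N` and then for a generator of `Γ/N`.

Bieberbach's theorem itself is proved by a descent on commutators
(`IsSpaceGroup.linPart_eq_one_of_lt`). -/

noncomputable section

/-! ### Linear parts of isometries: norm and commutator estimates. -/

namespace EucIsom

variable {n : ℕ}

/-- The linear part of an isometry of Euclidean space. -/
def linPart : EucIsom n →* (EucSpace n →L[ℝ] EucSpace n) where
  toFun g := (g.linearIsometryEquiv.toContinuousLinearEquiv : EucSpace n →L[ℝ] EucSpace n)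
  map_one' := rfl
  map_mul' _ _ := rfl

theorem linPart_apply (g : EucIsom n) (x : EucSpace n) :
    linPart g x = g.linearIsometryEquiv x := rfl

theorem apply_eq_linPart (g : EucIsom n) (x : EucSpace n) : g x = linPart g x + g 0 :=
  EucIsom.apply_eq g x

theorem norm_linPart_apply (g : EucIsom n) (x : EucSpace n) : ‖linPart g x‖ = ‖x‖ :=
  g.linearIsometryEquiv.norm_map x

theorem inner_linPart (g : EucIsom n) (x y : EucSpace n) :
    inner ℝ (linPart g x) (linPart g y) = inner ℝ x y :=
  g.linearIsometryEquiv.inner_map_map x y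

theorem opNorm_linPart_le_one (g : EucIsom n) : ‖linPart g‖ ≤ 1 :=
  ContinuousLinearMap.opNorm_le_bound _ zero_le_one fun x => by
    rw [norm_linPart_apply, one_mul]

theorem linPart_inv_mul (g : EucIsom n) : linPart g⁻¹ * linPart g = 1 := by
  rw [← map_mul, inv_mul_cancel, map_one]

theorem linPart_mul_inv (g : EucIsom n) : linPart g * linPart g⁻¹ = 1 := by
  rw [← map_mul, mul_inv_cancel, map_one]

theorem norm_linPart_inv_mul_sub_one_le (g h : EucIsom n) :
    ‖linPart (g⁻¹ * h) - 1‖ ≤ ‖linPart h - linPart g‖ := by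
  have : linPart (g⁻¹ * h) - 1 = linPart g⁻¹ * (linPart h - linPart g) := by
    rw [mul_sub, linPart_inv_mul, map_mul]
  rw [this]
  refine (norm_mul_le _ _).trans ?_
  exact mul_le_of_le_one_left (norm_nonneg _) (opNorm_linPart_le_one _)

theorem norm_linPart_mul_inv_sub_one_le (g h : EucIsom n) :
    ‖linPart (h * g⁻¹) - 1‖ ≤ ‖linPart h - linPart g‖ := by
  have : linPart (h * g⁻¹) - 1 = (linPart h - linPart g) * linPart g⁻¹ := by
    rw [sub_mul, linPart_mul_inv, map_mul]
  rw [this]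
  refine (norm_mul_le _ _).trans ?_
  exact mul_le_of_le_one_right (norm_nonneg _) (opNorm_linPart_le_one _)

theorem norm_linPart_conj_sub_one_le (g h : EucIsom n) :
    ‖linPart (g * h * g⁻¹) - 1‖ ≤ ‖linPart h - 1‖ := by
  refine (norm_linPart_mul_inv_sub_one_le _ _).trans ?_
  have : linPart (g * h) - linPart g = linPart g * (linPart h - 1) := by
    rw [mul_sub, map_mul, mul_one]
  rw [this]
  refine (norm_mul_le _ _).trans ?_
  exact mul_le_of_le_one_left (norm_nonneg _) (opNorm_linPart_le_one _)

theorem norm_linPart_commutator_sub_one_le (g h : EucIsom n) :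
    ‖linPart (g * h * g⁻¹ * h⁻¹) - 1‖ ≤ 2 * ‖linPart g - 1‖ * ‖linPart h - 1‖ := by
  have h0 : g * h * g⁻¹ * h⁻¹ = (g * h) * (h * g)⁻¹ := by group
  rw [h0]
  refine (norm_linPart_mul_inv_sub_one_le _ _).trans ?_
  have : linPart (g * h) - linPart (h * g)
      = (linPart g - 1) * (linPart h - 1) - (linPart h - 1) * (linPart g - 1) := by
    rw [map_mul, map_mul]
    simp only [sub_mul, mul_sub, one_mul, mul_one]
    abel
  rw [this]
  refine (norm_sub_le _ _).trans ?_
  have h1 := norm_mul_le (linPart g - 1) (linPart h - 1)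
  have h2 := norm_mul_le (linPart h - 1) (linPart g - 1)
  linarith

/-- Evaluate `g h = c (h g)` at the origin. The first term dominates; the bracket is an error
controlled by how far the linear part of `h` is from the identity. -/
theorem commutator_apply_zero (g h : EucIsom n) :
    (g * h * g⁻¹ * h⁻¹) 0 = (linPart g - 1) (h 0) - ((linPart (g * h * g⁻¹ * h⁻¹) - 1) (h 0)
      + (linPart (g * h * g⁻¹) - 1) (g 0)) := by
  set c := g * h * g⁻¹ * h⁻¹ with hc
  have h1 : g * h = c * (h * g) := by rw [hc]; group
  have h2 : g (h 0) = c (h (g 0)) := congrArg (fun k : EucIsom n => k 0) h1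
  have h3 : linPart (g * h * g⁻¹) = linPart c * linPart h := by
    rw [← map_mul]; congr 1; rw [hc]; group
  rw [apply_eq_linPart g, apply_eq_linPart c, apply_eq_linPart h (g 0), map_add] at h2
  rw [h3]
  simp only [sub_apply, one_apply_eq_self, mul_apply_eq_comp]
  rw [← sub_eq_iff_eq_add'] at h2
  rw [← h2]
  abel

/-- With `A` orthogonal and `y = (A - 1) b`, invariance of the inner product gives `⟨y, y⟩ = -⟨(A -
1) y, A b⟩`; then Cauchy–Schwarz. In effect, `A - 1` stretches `(A - 1) b` at least as much as it
stretches `b`. -/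
theorem norm_linPart_sub_one_apply_sq_le (g : EucIsom n) (b : EucSpace n) :
    ‖(linPart g - 1) b‖ ^ 2 ≤ ‖(linPart g - 1) ((linPart g - 1) b)‖ * ‖b‖ := by
  set y := (linPart g - 1) b with hy
  have h1 : inner ℝ y y = - inner ℝ ((linPart g - 1) y) (linPart g b) := by
    have h2 : inner ℝ y y = inner ℝ y (linPart g b) - inner ℝ y b := by
      conv_lhs => rw [hy]
      rw [← inner_sub_right]
      rfl
    rw [h2, ← inner_linPart g y b, sub_apply, inner_sub_left]
    simp
  rw [← real_inner_self_eq_norm_sq, h1]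
  refine (neg_le_abs _).trans ((abs_real_inner_le_norm _ _).trans ?_)
  rw [norm_linPart_apply]

theorem linPart_eq_one_iff (g : EucIsom n) : linPart g = 1 ↔ ∀ x, g x = g 0 + x := by
  constructor
  · intro h x
    rw [apply_eq_linPart, h, add_comm]; rfl
  · intro h
    ext1 x
    have := apply_eq_linPart g x
    rw [h x, add_comm] at this
    simpa using (add_right_cancel this).symm

theorem ext_linPart {g h : EucIsom n} (h1 : linPart g = linPart h) (h2 : g 0 = h 0) : g = h := by
  ext1 x
  rw [apply_eq_linPart g, apply_eq_linPart h, h1, h2]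

end EucIsom

open EucIsom

/-! ### Bieberbach's first theorem. -/

section Bieberbach

variable {n : ℕ} {Γ : Subgroup (EucIsom n)}

/-- Near the identity a discrete group of isometries has only the identity. -/
theorem IsSpaceGroup.exists_eq_one_of_small (hΓ : IsSpaceGroup Γ) :
    ∃ ε > 0, ∀ g ∈ Γ, ‖linPart g - 1‖ < ε → ‖g 0‖ < ε → g = 1 := by
  -- Affine maps depend continuously on linear part and translation vector, so a neighbourhood in
  -- the compact-open topology pulls back to a norm ball.
  let F : (EucSpace n →L[ℝ] EucSpace n) × EucSpace n → C(EucSpace n, EucSpace n) :=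
    fun p => ⟨fun x => p.1 x + p.2, by fun_prop⟩
  have hF : Continuous F := by
    refine ContinuousMap.continuous_of_continuous_uncurry _ ?_
    change Continuous fun q : ((EucSpace n →L[ℝ] EucSpace n) × EucSpace n) × EucSpace n =>
      q.1.1 q.2 + q.1.2
    fun_prop
  have hFg : ∀ g : EucIsom n, F (linPart g, g 0) = g.toContinuousMap := fun g => by
    ext1 x
    exact (apply_eq_linPart g x).symm
  have h1 : (1 : EucIsom n).toContinuousMap ∈ EucIsom.toContinuousMap '' (Γ : Set (EucIsom n)) :=
    ⟨1, Γ.one_mem, rfl⟩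
  have h2 : {(1 : EucIsom n).toContinuousMap} ∈
      nhdsWithin (1 : EucIsom n).toContinuousMap
        (EucIsom.toContinuousMap '' (Γ : Set (EucIsom n))) := by
    rw [isDiscrete_iff_nhdsWithin.1 hΓ.discrete _ h1]
    exact rfl
  obtain ⟨U, hU, hUΓ⟩ := mem_nhdsWithin_iff_exists_mem_nhds_inter.1 h2
  have h3 : F (1, 0) = (1 : EucIsom n).toContinuousMap := by
    rw [← hFg 1, map_one]; rfl
  rw [← h3] at hU
  obtain ⟨ε, hε, hball⟩ := Metric.mem_nhds_iff.1 (hF.continuousAt.preimage_mem_nhds hU)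
  refine ⟨ε, hε, fun g hg hg1 hg2 => ?_⟩
  have h4 : (linPart g, g 0) ∈
      Metric.ball ((1 : EucSpace n →L[ℝ] EucSpace n), (0 : EucSpace n)) ε := by
    rw [Metric.mem_ball, Prod.dist_eq, dist_eq_norm, dist_eq_norm, sub_zero]
    exact max_lt hg1 hg2
  have h5 := hUΓ ⟨hball h4, ⟨g, hg, (hFg g).symm⟩⟩
  rw [hFg] at h5
  ext1 x
  exact congrArg (fun f : C(EucSpace n, EucSpace n) => f x) h5

/-- Pigeonhole: linear parts and bounded translation vectors fill a totally bounded set, and two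
distinct elements too close together would have a nontrivial quotient near the identity. -/
theorem IsSpaceGroup.finite_norm_le (hΓ : IsSpaceGroup Γ) (r : ℝ) :
    {g : EucIsom n | g ∈ Γ ∧ ‖g 0‖ ≤ r}.Finite := by
  obtain ⟨ε, hε, hsmall⟩ := hΓ.exists_eq_one_of_small
  by_contra hinf
  let p : EucIsom n → (EucSpace n →L[ℝ] EucSpace n) × EucSpace n := fun g => (linPart g, g 0)
  have hproper : ProperSpace ((EucSpace n →L[ℝ] EucSpace n) × EucSpace n) :=
    FiniteDimensional.proper ℝ _
  have htb : TotallyBounded (Metric.closedBall (0 : (EucSpace n →L[ℝ] EucSpace n) × EucSpace n)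
      (max 1 r)) := (isCompact_closedBall _ _).totallyBounded
  obtain ⟨t, ht, hcov⟩ := Metric.totallyBounded_iff.1 htb (ε / 2) (by positivity)
  have hmem : ∀ g : EucIsom n, g ∈ Γ ∧ ‖g 0‖ ≤ r → ∃ y ∈ t, dist (p g) y < ε / 2 := by
    intro g hg
    have h1 : p g ∈ Metric.closedBall (0 : (EucSpace n →L[ℝ] EucSpace n) × EucSpace n)
        (max 1 r) := by
      rw [mem_closedBall_zero_iff, Prod.norm_def]
      exact max_le_max (opNorm_linPart_le_one g) hg.2
    simpa using hcov h1
  choose! c hct hcd using hmem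
  obtain ⟨g, hg, h, hh, hne, heq⟩ :=
    Set.Infinite.exists_ne_map_eq_of_mapsTo (f := c) hinf (fun g hg => hct g hg) ht
  have hd : dist (p h) (p g) < ε := by
    have h1 := hcd g hg
    have h2 := hcd h hh
    rw [heq] at h1
    have := dist_triangle_right (p h) (p g) (c h)
    linarith
  rw [Prod.dist_eq, max_lt_iff, dist_eq_norm, dist_eq_norm] at hd
  have h1 := hsmall (g⁻¹ * h) (Γ.mul_mem (Γ.inv_mem hg.1) hh.1)
    ((norm_linPart_inv_mul_sub_one_le g h).trans_lt hd.1) (by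
      have : linPart g ((g⁻¹ * h) 0) = h 0 - g 0 := by
        rw [eq_sub_iff_add_eq, ← apply_eq_linPart]
        exact g.apply_symm_apply _
      rw [← norm_linPart_apply g, this]
      exact hd.2)
  exact hne (inv_mul_eq_one.1 h1)

theorem IsSpaceGroup.exists_minimal (hΓ : IsSpaceGroup Γ) {P : EucIsom n → Prop}
    (hP : ∃ g ∈ Γ, P g) : ∃ g ∈ Γ, P g ∧ ∀ h ∈ Γ, P h → ‖g 0‖ ≤ ‖h 0‖ := by
  obtain ⟨g₀, hg₀, hPg₀⟩ := hP
  have hfin : {g : EucIsom n | (g ∈ Γ ∧ ‖g 0‖ ≤ ‖g₀ 0‖) ∧ P g}.Finite :=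
    (hΓ.finite_norm_le ‖g₀ 0‖).subset fun g hg => hg.1
  obtain ⟨g, hg, hmin⟩ := Set.exists_min_image _ (fun g : EucIsom n => ‖g 0‖) hfin
    ⟨g₀, ⟨hg₀, le_rfl⟩, hPg₀⟩
  refine ⟨g, hg.1.1, hg.2, fun h hh hPh => ?_⟩
  rcases le_total ‖h 0‖ ‖g₀ 0‖ with h1 | h1
  · exact hmin h ⟨⟨hh, h1⟩, hPh⟩
  · exact hg.1.2.trans h1

/-- Images of balls around the origin form an open cover of the compact orbit space, so one ball
meets every orbit. -/
theorem IsSpaceGroup.exists_norm_sub_le (hΓ : IsSpaceGroup Γ) :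
    ∃ d : ℝ, ∀ x : EucSpace n, ∃ g ∈ Γ, ‖g 0 - x‖ ≤ d := by
  have : ContinuousConstSMul Γ (EucSpace n) := ⟨fun g => (g : EucIsom n).continuous⟩
  have hopen := isOpenMap_quotient_mk'_mul (Γ := Γ) (T := EucSpace n)
  have := hΓ.cocompact
  obtain ⟨s, hs⟩ := isCompact_univ.elim_finite_subcover
    (fun k : ℕ => (Quotient.mk (MulAction.orbitRel Γ (EucSpace n))) ''
      Metric.ball (0 : EucSpace n) k)
    (fun k => hopen _ Metric.isOpen_ball) (by
      intro q _
      obtain ⟨x, rfl⟩ := Quotient.exists_rep q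
      obtain ⟨k, hk⟩ := exists_nat_gt ‖x‖
      exact Set.mem_iUnion.2 ⟨k, x, by simpa using hk, rfl⟩)
  refine ⟨((s.sup id : ℕ) : ℝ), fun x => ?_⟩
  have hx := hs (Set.mem_univ (Quotient.mk (MulAction.orbitRel Γ (EucSpace n)) x))
  simp only [Set.mem_iUnion] at hx
  obtain ⟨k, hk, y, hy, hyx⟩ := hx
  obtain ⟨g, hg⟩ := MulAction.orbitRel_apply.1 (Quotient.exact hyx.symm)
  refine ⟨g, g.2, ?_⟩
  have h1 : x = (g : EucIsom n) y := hg.symm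
  rw [h1, ← dist_eq_norm, (g : EucIsom n).dist_map, dist_zero_left]
  have h2 : ‖y‖ < k := by simpa using hy
  refine h2.le.trans ?_
  exact_mod_cast Finset.le_sup (f := id) hk

/-- A space group has elements with linear part close to the identity that move the origin
in nearly any given direction. -/
theorem IsSpaceGroup.exists_almost_translation (hΓ : IsSpaceGroup Γ) {u : EucSpace n}
    (hu : u ≠ 0) {ε : ℝ} (hε : 0 < ε) :
    ∃ g ∈ Γ, g 0 ≠ 0 ∧ ‖linPart g - 1‖ ≤ ε ∧ ∃ t : ℝ, 0 < t ∧ ‖g 0 - t • u‖ ≤ ε * ‖g 0‖ := by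
  obtain ⟨d, hd⟩ := hΓ.exists_norm_sub_le
  choose β hβΓ hβ using fun k : ℕ => hd ((k : ℝ) • u)
  have hproper : ProperSpace (EucSpace n →L[ℝ] EucSpace n) := FiniteDimensional.proper ℝ _
  obtain ⟨A, -, φ, hφ, hlim⟩ :=
    (isCompact_closedBall (0 : EucSpace n →L[ℝ] EucSpace n) 1).tendsto_subseq
    (x := fun k => linPart (β k)) (fun k => by
      rw [mem_closedBall_zero_iff]; exact opNorm_linPart_le_one _)
  obtain ⟨N, hN⟩ := Metric.cauchySeq_iff.1 hlim.cauchySeq ε hε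
  have hu' : 0 < ‖u‖ := norm_pos_iff.2 hu
  -- `R` bounds `‖g 0 - t • u‖` however far out `l` is taken, while `t` grows with `l`; `j` is
  -- chosen so that this error is at most `ε * ‖g 0‖`.
  set R : ℝ := 2 * d + 2 * ‖β (φ N) 0‖ with hR
  have hd0 : 0 ≤ d := (norm_nonneg _).trans (hβ 0)
  have hR0 : 0 ≤ R := by positivity
  obtain ⟨j, hj⟩ := exists_nat_gt ((R + R / ε) / ‖u‖)
  set l := N + j + 1 with hl
  set t : ℝ := φ l - φ N with ht
  have htj : (j : ℝ) + 1 ≤ t := by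
    have h1 : φ N + (j + 1) ≤ φ l := by
      have : ∀ i, φ N + i ≤ φ (N + i) := fun i => by
        induction i with
        | zero => exact le_rfl
        | succ i ih => exact ih.trans_lt (hφ (Nat.lt_succ_self (N + i)))
      exact this (j + 1)
    rw [ht, le_sub_iff_add_le']
    exact_mod_cast h1
  have hRε : 0 ≤ R / ε := by positivity
  have htu : R + R / ε < t * ‖u‖ := by
    rw [div_lt_iff₀ hu'] at hj
    nlinarith
  set g := β (φ l) * (β (φ N))⁻¹ with hg
  have hgA : ‖linPart g - 1‖ ≤ ε := by
    refine (norm_linPart_mul_inv_sub_one_le _ _).trans ?_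
    rw [← dist_eq_norm]
    exact (hN l (by omega) N le_rfl).le
  have hgR : ‖g 0 - t • u‖ ≤ R := by
    have h1 : g (β (φ N) 0) = β (φ l) 0 := by
      rw [hg]
      change β (φ l) ((β (φ N))⁻¹ (β (φ N) 0)) = _
      congr 1
      exact (β (φ N)).symm_apply_apply 0
    rw [apply_eq_linPart] at h1
    have h2 : g 0 - t • u = (β (φ l) 0 - (φ l : ℝ) • u) - (β (φ N) 0 - (φ N : ℝ) • u)
        + (β (φ N) 0 - linPart g (β (φ N) 0)) := by
      rw [← h1, ht, sub_smul]; abel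
    rw [h2]
    have h3 := norm_add_le ((β (φ l) 0 - (φ l : ℝ) • u) - (β (φ N) 0 - (φ N : ℝ) • u))
        (β (φ N) 0 - linPart g (β (φ N) 0))
    have h4 := norm_sub_le (β (φ l) 0 - (φ l : ℝ) • u) (β (φ N) 0 - (φ N : ℝ) • u)
    have h5 := norm_sub_le (β (φ N) 0) (linPart g (β (φ N) 0))
    rw [norm_linPart_apply] at h5
    have h6 := hβ (φ l)
    have h7 := hβ (φ N)
    linarith
  have htpos : 0 < t := by
    have : (0 : ℝ) ≤ j := j.cast_nonneg
    linarith
  have hg0 : R / ε < ‖g 0‖ := by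
    have h1 := norm_sub_norm_le (t • u) (g 0)
    rw [norm_smul, Real.norm_of_nonneg htpos.le, norm_sub_rev] at h1
    linarith
  refine ⟨g, Γ.mul_mem (hβΓ _) (Γ.inv_mem (hβΓ _)), ?_, hgA, t, htpos, hgR.trans ?_⟩
  · exact norm_pos_iff.1 (hRε.trans_lt hg0)
  · rw [div_lt_iff₀ hε] at hg0
    linarith

/-- A space group contains elements with linear part close to the identity and with translation
part nearly maximally stretched by a given operator `D`. -/
theorem IsSpaceGroup.exists_almost_maximally_stretched (hΓ : IsSpaceGroup Γ)
    {D : EucSpace n →L[ℝ] EucSpace n} {m C : ℝ} (hm : m = ‖D‖) (hm0 : 0 < m) (hC8 : 0 < C) :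
    ∃ h ∈ Γ, h 0 ≠ 0 ∧ (m / 2 + C * ‖linPart h - 1‖) * ‖h 0‖ ≤ ‖D (h 0)‖ := by
  obtain ⟨u, hu⟩ : ∃ u, 3 / 4 * m * ‖u‖ < ‖D u‖ := by
    by_contra! hcon
    have := D.opNorm_le_bound (by positivity) hcon
    linarith
  have hu0 : u ≠ 0 := by
    rintro rfl
    simp at hu
  -- The gap between the stretch `3/4 * m` of `u` and the required `m / 2` is `m / 4`; this `ε`
  -- makes all losses fit into it.
  set ε := m / (4 * (2 * m + C)) with hε
  have hε0 : 0 < ε := by positivity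
  have hε1 : (2 * m + C) * ε = m / 4 := by
    rw [hε]; field_simp
  obtain ⟨h, hh, h0, hhε, t, ht, htu⟩ := hΓ.exists_almost_translation hu0 hε0
  refine ⟨h, hh, h0, ?_⟩
  have h1 : t * ‖D u‖ - m * (ε * ‖h 0‖) ≤ ‖D (h 0)‖ := by
    have h2 : ‖D (h 0 - t • u)‖ ≤ m * (ε * ‖h 0‖) :=
      (D.le_opNorm _).trans (by rw [← hm]; exact mul_le_mul_of_nonneg_left htu hm0.le)
    have h3 := norm_sub_norm_le (D (t • u)) (D (h 0))
    rw [norm_sub_rev, ← map_sub, map_smul, norm_smul, Real.norm_of_nonneg ht.le] at h3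
    linarith
  have h4 : (1 - ε) * ‖h 0‖ ≤ t * ‖u‖ := by
    have h3 := norm_sub_norm_le (h 0) (t • u)
    rw [norm_smul, Real.norm_of_nonneg ht.le] at h3
    linarith
  have hx := norm_nonneg (h 0)
  have h5 : t * (3 / 4 * m * ‖u‖) ≤ t * ‖D u‖ := mul_le_mul_of_nonneg_left hu.le ht.le
  have h6 : 3 / 4 * m * ((1 - ε) * ‖h 0‖) ≤ 3 / 4 * m * (t * ‖u‖) :=
    mul_le_mul_of_nonneg_left h4 (by positivity)
  have h7 : C * ‖linPart h - 1‖ * ‖h 0‖ ≤ C * ε * ‖h 0‖ := by gcongr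
  have h8 : (2 * m + C) * ε * ‖h 0‖ = m / 4 * ‖h 0‖ := by rw [hε1]
  have h9 : 0 ≤ m * ε * ‖h 0‖ := by positivity
  nlinarith

/-- Elements of a space group whose linear part is close to the identity are translations. -/
theorem IsSpaceGroup.linPart_eq_one_of_lt (hΓ : IsSpaceGroup Γ) {g : EucIsom n} (hg : g ∈ Γ)
    (hlt : ‖linPart g - 1‖ < 1 / 2) : linPart g = 1 := by
  by_contra hne
  obtain ⟨α, hα, ⟨hα1, hα2⟩, hαmin⟩ := hΓ.exists_minimal
    (P := fun h => linPart h ≠ 1 ∧ ‖linPart h - 1‖ < 1 / 2) ⟨g, hg, hne, hlt⟩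
  set D := linPart α - 1 with hD
  set m := ‖D‖ with hm
  have hm0 : 0 < m := norm_pos_iff.2 (sub_ne_zero.2 hα1)
  -- With this `C`, `C * (2 * m * η) = C * η - 8 * η`: passing to the commutator lowers the required
  -- stretch by `8 * η`, which pays for the errors of order `η`.
  set C := 8 / (1 - 2 * m) with hC
  have hq : 0 < 1 - 2 * m := by linarith
  have hC1 : C * (1 - 2 * m) = 8 := div_mul_cancel₀ _ hq.ne'
  have hC8 : 8 ≤ C := by
    rw [hC, le_div_iff₀ hq]; linarith
  obtain ⟨β, hβ, ⟨hβ0, hβD⟩, hβmin⟩ := hΓ.exists_minimal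
    (P := fun h => h 0 ≠ 0 ∧ (m / 2 + C * ‖linPart h - 1‖) * ‖h 0‖ ≤ ‖D (h 0)‖)
    (hΓ.exists_almost_maximally_stretched hm hm0 (by linarith))
  set η := ‖linPart β - 1‖ with hη
  have hη0 : 0 ≤ η := norm_nonneg _
  set x := ‖β 0‖ with hx
  have hx0 : 0 < x := norm_pos_iff.2 hβ0
  set y := ‖D (β 0)‖ with hy
  have hym : y ≤ m * x := D.le_opNorm _
  have hρm : m / 2 + C * η ≤ m := le_of_mul_le_mul_right (hβD.trans hym) hx0
  have h8η : 8 * η ≤ C * η := mul_le_mul_of_nonneg_right hC8 hη0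
  have hηm : 16 * η ≤ m := by linarith
  -- Unless `η = 0`, `β` competes with `α` for minimality, as `η ≤ m / 16`.
  have hηa : η * ‖α 0‖ ≤ η * x := by
    by_cases hβ1 : linPart β = 1
    · rw [hη, hβ1, sub_self, norm_zero, zero_mul, zero_mul]
    · exact mul_le_mul_of_nonneg_left (hαmin β hβ ⟨hβ1, by linarith⟩) hη0
  -- The commutator satisfies the condition defining `β` but moves the origin less, against
  -- minimality.
  set c := α * β * α⁻¹ * β⁻¹ with hc
  have hcΓ : c ∈ Γ := Γ.mul_mem (Γ.mul_mem (Γ.mul_mem hα hβ) (Γ.inv_mem hα)) (Γ.inv_mem hβ)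
  have hcη : ‖linPart c - 1‖ ≤ 2 * m * η := norm_linPart_commutator_sub_one_le α β
  set r := (linPart c - 1) (β 0) + (linPart (α * β * α⁻¹) - 1) (α 0) with hr
  have hc0 : c 0 = D (β 0) - r := commutator_apply_zero α β
  have hrle : ‖r‖ ≤ 2 * η * x := by
    have h1 : ‖(linPart c - 1) (β 0)‖ ≤ η * x := by
      refine ((linPart c - 1).le_opNorm _).trans (mul_le_mul_of_nonneg_right ?_ hx0.le)
      nlinarith
    have h2 : ‖(linPart (α * β * α⁻¹) - 1) (α 0)‖ ≤ η * ‖α 0‖ :=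
      ((linPart (α * β * α⁻¹) - 1).le_opNorm _).trans
        (mul_le_mul_of_nonneg_right (norm_linPart_conj_sub_one_le α β) (norm_nonneg _))
    have h3 := norm_add_le ((linPart c - 1) (β 0)) ((linPart (α * β * α⁻¹) - 1) (α 0))
    linarith
  have hsq : y ^ 2 ≤ ‖D (D (β 0))‖ * x := norm_linPart_sub_one_apply_sq_le α (β 0)
  have hc_le : ‖c 0‖ ≤ y + 2 * η * x := by
    rw [hc0]; exact (norm_sub_le _ _).trans (by linarith)
  have hc_ge : y - 2 * η * x ≤ ‖c 0‖ := by
    rw [hc0]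
    have := norm_sub_norm_le (D (β 0)) r
    linarith
  have hDc : ‖D (D (β 0))‖ - m * (2 * η * x) ≤ ‖D (c 0)‖ := by
    rw [hc0, map_sub]
    have h1 := norm_sub_norm_le (D (D (β 0))) (D r)
    have h2 : ‖D r‖ ≤ m * (2 * η * x) :=
      (D.le_opNorm r).trans (mul_le_mul_of_nonneg_left hrle hm0.le)
    linarith
  have hlt' : ‖c 0‖ < x := by nlinarith
  refine absurd (hβmin c hcΓ ⟨?_, ?_⟩) (not_le.2 hlt')
  · refine norm_pos_iff.1 (lt_of_lt_of_le ?_ hc_ge)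
    have : 0 < (m / 2 + C * η - 2 * η) * x := mul_pos (by linarith) hx0
    linarith
  · obtain ⟨ρ, hρ⟩ : ∃ ρ, y = ρ * x := ⟨y / x, (div_mul_cancel₀ _ hx0.ne').symm⟩
    rw [hρ] at hβD hc_le hsq
    have hρ1 : m / 2 + C * η ≤ ρ := le_of_mul_le_mul_right hβD hx0
    have hz : ρ ^ 2 * x ≤ ‖D (D (β 0))‖ := by
      refine le_of_mul_le_mul_right ?_ hx0
      linarith
    have h1 : C * ‖linPart c - 1‖ ≤ C * η - 8 * η := by
      have := mul_le_mul_of_nonneg_left hcη (by linarith : 0 ≤ C)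
      linear_combination this - η * hC1
    have h2 : m / 2 + C * ‖linPart c - 1‖ ≤ ρ - 8 * η := by linarith
    have h3 : (m / 2 + C * ‖linPart c - 1‖) * ‖c 0‖ ≤ (ρ - 8 * η) * (ρ * x + 2 * η * x) :=
      mul_le_mul h2 hc_le (norm_nonneg _) (by linarith)
    have h4 : (ρ - 8 * η) * (ρ + 2 * η) ≤ ρ ^ 2 - 2 * m * η := by nlinarith
    have h5 := mul_le_mul_of_nonneg_right h4 hx0.le
    linear_combination h3 + h5 + hz + hDc

/-- The translations in a space group span the ambient space. -/
theorem IsSpaceGroup.span_translations (hΓ : IsSpaceGroup Γ) (W : Submodule ℝ (EucSpace n))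
    (hW : ∀ g ∈ Γ, linPart g = 1 → g 0 ∈ W) : W = ⊤ := by
  by_contra hne
  obtain ⟨u, huW, hu⟩ := (Submodule.ne_bot_iff _).1
    (mt (Submodule.orthogonal_eq_bot_iff (K := W)).1 hne)
  -- Such a `g` is a translation nearly along `u`, yet its vector lies in `W`, orthogonal to `u`.
  obtain ⟨g, hg, hg0, hgε, t, ht, htu⟩ := hΓ.exists_almost_translation hu
    (show (0 : ℝ) < 1 / 4 by norm_num)
  have hgW := hW g hg (hΓ.linPart_eq_one_of_lt hg (by linarith))
  have h1 : inner ℝ (g 0) (t • u) = 0 := by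
    rw [inner_smul_right, huW _ hgW, mul_zero]
  have h2 := norm_sub_sq_real (g 0) (t • u)
  rw [h1] at h2
  have h3 : 0 < ‖g 0‖ := norm_pos_iff.2 hg0
  nlinarith [norm_nonneg (g 0 - t • u), sq_nonneg ‖t • u‖]

/-- Every element of a space group has a positive power that is a translation. -/
theorem IsSpaceGroup.exists_pow_linPart_eq_one (hΓ : IsSpaceGroup Γ) {g : EucIsom n}
    (hg : g ∈ Γ) : ∃ k : ℕ, 0 < k ∧ linPart (g ^ k) = 1 := by
  have hproper : ProperSpace (EucSpace n →L[ℝ] EucSpace n) := FiniteDimensional.proper ℝ _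
  obtain ⟨A, -, φ, hφ, hlim⟩ :=
    (isCompact_closedBall (0 : EucSpace n →L[ℝ] EucSpace n) 1).tendsto_subseq
    (x := fun k => linPart (g ^ k)) (fun k => by
      rw [mem_closedBall_zero_iff]; exact opNorm_linPart_le_one _)
  obtain ⟨N, hN⟩ := Metric.cauchySeq_iff.1 hlim.cauchySeq (1 / 2) (by norm_num)
  have hlt : φ N < φ (N + 1) := hφ (Nat.lt_succ_self N)
  refine ⟨φ (N + 1) - φ N, by omega, hΓ.linPart_eq_one_of_lt (Γ.pow_mem hg _) ?_⟩
  rw [pow_sub g hlt.le]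
  refine (norm_linPart_mul_inv_sub_one_le _ _).trans_lt ?_
  rw [← dist_eq_norm]
  exact hN (N + 1) (by omega) N le_rfl

end Bieberbach

/-! ### `V^⊥` is a line on which `Γ` acts by translations. -/

section PerpLine

variable {n : ℕ} {Γ : Subgroup (EucIsom n)}

/-- A translation is determined by its translation vector, homomorphically. -/
def EucIsom.translationVector : (linPart (n := n)).ker →* Multiplicative (EucSpace n) where
  toFun g := Multiplicative.ofAdd ((g : EucIsom n) 0)
  map_one' := rfl
  map_mul' g h := by
    rw [← ofAdd_add]
    congr 1
    exact (linPart_eq_one_iff _).1 g.2 ((h : EucIsom n) 0)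

theorem EucIsom.zpow_apply_zero {g : EucIsom n} (hg : linPart g = 1) (k : ℤ) :
    (g ^ k) 0 = k • g 0 :=
  congrArg Multiplicative.toAdd (map_zpow translationVector (⟨g, hg⟩ : (linPart (n := n)).ker) k)

theorem EucIsom.linPart_zpow {g : EucIsom n} (hg : linPart g = 1) (k : ℤ) :
    linPart (g ^ k) = 1 :=
  (linPart (n := n)).ker.zpow_mem hg k

theorem exists_surjective_hom_int {G : Type*} [Group G] (N : Subgroup G) [N.Normal]
    (hcyc : IsCyclic (G ⧸ N)) (hinf : Infinite (G ⧸ N)) :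
    ∃ χ : G →* Multiplicative ℤ, Function.Surjective χ ∧ χ.ker = N := by
  obtain ⟨g, hg⟩ := hcyc.exists_zpow_surjective
  have htop : Subgroup.zpowers g = ⊤ := (Subgroup.eq_top_iff' _).2 fun x => hg x
  let e := intEquivOfZPowersEqTop g htop
  refine ⟨e.symm.toMonoidHom.comp (QuotientGroup.mk' N),
    e.symm.surjective.comp (QuotientGroup.mk'_surjective N), ?_⟩
  ext x
  rw [MonoidHom.mem_ker, MonoidHom.comp_apply]
  change e.symm (QuotientGroup.mk' N x) = 1 ↔ _
  rw [map_eq_one_iff _ e.symm.injective]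
  exact QuotientGroup.eq_one_iff x

theorem zpow_smul_eq_add {G A : Type*} [Group G] [AddCommGroup A] [MulAction G A] {g : G} {c : A}
    (h : ∀ w : A, g • w = w + c) (k : ℤ) (w : A) : (g ^ k) • w = w + k • c := by
  have hinv : ∀ w : A, g⁻¹ • w = w - c := fun w => by
    rw [inv_smul_eq_iff, h, sub_add_cancel]
  induction k using Int.induction_on generalizing w with
  | zero => simp
  | succ i ih => rw [zpow_add_one, mul_smul, h, ih, add_smul, one_smul]; abel
  | pred i ih => rw [zpow_sub_one, mul_smul, hinv, ih, sub_smul, one_smul]; abel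

theorem eq_zero_of_add_self_eq_zero {E : Type*} [AddCommGroup E] [Module ℝ E] {a : E}
    (h : a + a = 0) : a = 0 := by
  rw [← two_smul ℝ] at h
  exact (smul_eq_zero.1 h).resolve_left two_ne_zero

variable (N : Subgroup Γ)

theorem apply_zero_mem_spanOf {g : Γ} (hg : g ∈ N) (hlin : linPart (g : EucIsom n) = 1) :
    (g : EucIsom n) 0 ∈ spanOf N :=
  Submodule.subset_span ⟨g, hg, (linPart_eq_one_iff _).1 hlin⟩

theorem exists_eq_smul_of_spanOf_sup {a : EucSpace n}
    (h : spanOf N ⊔ Submodule.span ℝ {a} = ⊤)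
    (w : ((spanOf N)ᗮ : Submodule ℝ (EucSpace n))) :
    ∃ x : ℝ, w = x • (spanOf N)ᗮ.orthogonalProjectionOnto a := by
  have h1 : (w : EucSpace n) ∈ spanOf N ⊔ Submodule.span ℝ {a} := h ▸ Submodule.mem_top
  obtain ⟨v, hv, y, hy, hvy⟩ := Submodule.mem_sup.1 h1
  obtain ⟨x, rfl⟩ := Submodule.mem_span_singleton.1 hy
  refine ⟨x, ?_⟩
  have h2 : (spanOf N)ᗮ.orthogonalProjectionOnto v = 0 := by
    rwa [Submodule.orthogonalProjectionOnto_eq_zero_iff, Submodule.orthogonal_orthogonal]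
  rw [← Submodule.orthogonalProjectionOnto_mem_subspace_eq_self w, ← hvy, map_add, h2, zero_add,
    map_smul]

/-- For a translation `s`, the element `s ^ χ(t) * t ^ (-χ(s))` is a translation in `N`. Its vector
lies in `V`, and dividing by `χ(t) ≠ 0` expresses that of `s`. -/
theorem spanOf_sup_span_singleton (hΓ : IsSpaceGroup Γ) {χ : Γ →* Multiplicative ℤ}
    (hχ : χ.ker = N) {t : Γ} (ht : linPart (t : EucIsom n) = 1)
    (ht0 : (t : EucIsom n) 0 ∉ spanOf N) :
    spanOf N ⊔ Submodule.span ℝ {(t : EucIsom n) 0} = ⊤ := by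
  refine hΓ.span_translations _ fun s hs hlin => ?_
  lift s to Γ using hs
  set a : ℤ := (χ t).toAdd with ha
  set b : ℤ := (χ s).toAdd with hb
  have ha0 : a ≠ 0 := fun h0 => ht0 (apply_zero_mem_spanOf N (by
    rw [← hχ, MonoidHom.mem_ker]
    exact Multiplicative.toAdd.injective h0) ht)
  have hmem : s ^ a * t ^ (-b) ∈ N := by
    rw [← hχ, MonoidHom.mem_ker, map_mul, map_zpow, map_zpow]
    apply Multiplicative.toAdd.injective
    rw [toAdd_mul, toAdd_zpow, toAdd_zpow, ← ha, ← hb, toAdd_one, smul_eq_mul, smul_eq_mul]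
    ring
  have hlin1 : linPart ((s ^ a : Γ) : EucIsom n) = 1 := by
    rw [Subgroup.coe_zpow]; exact linPart_zpow hlin a
  have hlin2 : linPart ((t ^ (-b) : Γ) : EucIsom n) = 1 := by
    rw [Subgroup.coe_zpow]; exact linPart_zpow ht (-b)
  have h1 := apply_zero_mem_spanOf N hmem (by
    rw [Subgroup.coe_mul, map_mul, hlin1, hlin2, one_mul])
  have h2 : ((s ^ a * t ^ (-b) : Γ) : EucIsom n) 0
      = a • (s : EucIsom n) 0 + (-b) • (t : EucIsom n) 0 := by
    rw [← zpow_apply_zero hlin, ← zpow_apply_zero ht]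
    exact (linPart_eq_one_iff _).1 hlin1 _
  have h3 : (s : EucIsom n) 0 = (a : ℝ)⁻¹ • ((s ^ a * t ^ (-b) : Γ) : EucIsom n) 0
      + ((a : ℝ)⁻¹ * b) • (t : EucIsom n) 0 := by
    have ha0' : (a : ℝ) ≠ 0 := by exact_mod_cast ha0
    rw [h2, ← Int.cast_smul_eq_zsmul ℝ a, ← Int.cast_smul_eq_zsmul ℝ (-b), smul_add, smul_smul,
      smul_smul, inv_mul_cancel₀ ha0', one_smul, add_assoc, ← add_smul]
    push_cast
    simp
  rw [h3]
  exact Submodule.add_mem_sup (Submodule.smul_mem _ _ h1)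
    (Submodule.smul_mem _ _ (Submodule.mem_span_singleton_self _))

variable [N.Normal]

theorem kernelOf_eq_bot (h : spanOf N = ⊤) : kernelOf N = ⊥ := by
  refine (Subgroup.eq_bot_iff_forall _).2 fun g hg => ?_
  obtain ⟨h1, h2⟩ := (mem_kernelOf_iff N g).1 hg
  rw [h, Submodule.top_orthogonal_eq_bot, Submodule.mem_bot] at h1
  refine Subtype.ext (ext_linPart ?_ h1)
  ext1 x
  exact h2 x (h ▸ Submodule.mem_top)

theorem perpAction_eq_of_linPart_eq_one {t : Γ} (ht : linPart (t : EucIsom n) = 1)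
    (w : ((spanOf N)ᗮ : Submodule ℝ (EucSpace n))) :
    t • w = w + (spanOf N)ᗮ.orthogonalProjectionOnto ((t : EucIsom n) 0) := by
  apply Subtype.ext
  rw [perpAction_coe, ← linPart_apply, ht]
  rfl

/-- Some power `g ^ k` is a translation in `N`, with vector in `V`, so it fixes `V^⊥` pointwise and
`k c = 0`. -/
theorem eq_zero_of_mem_of_smul_eq_add (hΓ : IsSpaceGroup Γ) {g : Γ} (hg : g ∈ N)
    {c : ((spanOf N)ᗮ : Submodule ℝ (EucSpace n))} (hc : ∀ w, g • w = w + c) : c = 0 := by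
  obtain ⟨k, hk, hlin⟩ := hΓ.exists_pow_linPart_eq_one g.2
  have hlin' : linPart ((g ^ k : Γ) : EucIsom n) = 1 := hlin
  have h1 := perpAction_eq_of_linPart_eq_one N hlin' 0
  have h2 : (spanOf N)ᗮ.orthogonalProjectionOnto (((g ^ k : Γ) : EucIsom n) 0) = 0 := by
    rw [Submodule.orthogonalProjectionOnto_eq_zero_iff, Submodule.orthogonal_orthogonal]
    exact apply_zero_mem_spanOf N (N.pow_mem hg k) hlin'
  rw [h2, add_zero, ← zpow_natCast, zpow_smul_eq_add hc, zero_add, natCast_zsmul,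
    ← Nat.cast_smul_eq_nsmul ℝ] at h1
  exact (smul_eq_zero.1 h1).resolve_left (Nat.cast_ne_zero.2 hk.ne')

/-- If `Γ/N` is infinite cyclic and `Γ/NK` is finite, then some translation in `Γ` has a component
orthogonal to `Span(N)`. -/
theorem exists_translation_not_mem_spanOf (hΓ : IsSpaceGroup Γ) (hinf : Infinite (Γ ⧸ N))
    (hfin : Finite (StructureGroup N)) :
    ∃ t : Γ, linPart (t : EucIsom n) = 1 ∧ (t : EucIsom n) 0 ∉ spanOf N := by
  by_contra! hcon
  have htop := hΓ.span_translations (spanOf N) fun g hg hlin => hcon ⟨g, hg⟩ hlin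
  have h1 : N ⊔ kernelOf N = N := by rw [kernelOf_eq_bot N htop, sup_bot_eq]
  have h2 : Finite (Γ ⧸ (N ⊔ kernelOf N)) := hfin
  rw [h1] at h2
  exact not_finite (Γ ⧸ N)

theorem perpAction_eq_add_or_eq_neg_add {a : ((spanOf N)ᗮ : Submodule ℝ (EucSpace n))}
    (ha : a ≠ 0) (h : ∀ w : ((spanOf N)ᗮ : Submodule ℝ (EucSpace n)), ∃ x : ℝ, w = x • a) (g : Γ) :
    ∃ c : ((spanOf N)ᗮ : Submodule ℝ (EucSpace n)),
      (∀ w : ((spanOf N)ᗮ : Submodule ℝ (EucSpace n)), g • w = w + c) ∨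
      (∀ w : ((spanOf N)ᗮ : Submodule ℝ (EucSpace n)), g • w = -w + c) := by
  obtain ⟨s, hs⟩ := h ⟨_, linear_mem_perp N g a.2⟩
  have hs' : (g : EucIsom n).linearIsometryEquiv (a : EucSpace n) = s • (a : EucSpace n) :=
    congrArg Subtype.val hs
  have hnorm : |s| = 1 := by
    have h1 := (g : EucIsom n).linearIsometryEquiv.norm_map (a : EucSpace n)
    rw [hs', norm_smul, Real.norm_eq_abs] at h1
    have h2 : ‖(a : EucSpace n)‖ ≠ 0 := by simpa using ha
    exact mul_right_cancel₀ h2 (h1.trans (one_mul _).symm)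
  have hact : ∀ w : ((spanOf N)ᗮ : Submodule ℝ (EucSpace n)),
      g • w = s • w + (spanOf N)ᗮ.orthogonalProjectionOnto ((g : EucIsom n) 0) := fun w => by
    obtain ⟨x, rfl⟩ := h w
    apply Subtype.ext
    rw [perpAction_coe, Submodule.coe_add, Submodule.coe_smul, Submodule.coe_smul, map_smul, hs',
      smul_comm, Submodule.coe_smul]
  refine ⟨(spanOf N)ᗮ.orthogonalProjectionOnto ((g : EucIsom n) 0), ?_⟩
  rcases eq_or_eq_neg_of_abs_eq hnorm with rfl | rfl
  · exact Or.inl fun w => by rw [hact, one_smul]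
  · exact Or.inr fun w => by rw [hact, neg_smul, one_smul]

theorem smul_eq_self_of_mem (hΓ : IsSpaceGroup Γ)
    {a : ((spanOf N)ᗮ : Submodule ℝ (EucSpace n))}
    (ha : a ≠ 0) (h : ∀ w : ((spanOf N)ᗮ : Submodule ℝ (EucSpace n)), ∃ x : ℝ, w = x • a)
    {t : Γ} (ht : ∀ w : ((spanOf N)ᗮ : Submodule ℝ (EucSpace n)), t • w = w + a)
    {g : Γ} (hg : g ∈ N) (w : ((spanOf N)ᗮ : Submodule ℝ (EucSpace n))) : g • w = w := by
  obtain ⟨c, hc | hc⟩ := perpAction_eq_add_or_eq_neg_add N ha h g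
  · rw [hc, eq_zero_of_mem_of_smul_eq_add N hΓ hg hc, add_zero]
  -- If `g` reflected the line, its commutator with `t`, which is in `N`, would translate by `2a ≠
  -- 0`.
  · exfalso
    have hginv : ∀ w : ((spanOf N)ᗮ : Submodule ℝ (EucSpace n)), g⁻¹ • w = -w + c := fun w => by
      rw [inv_smul_eq_iff, hc]; abel
    have htinv : ∀ w : ((spanOf N)ᗮ : Submodule ℝ (EucSpace n)), t⁻¹ • w = w - a := fun w => by
      rw [inv_smul_eq_iff, ht]; abel
    have hmem : (t * g * t⁻¹) * g⁻¹ ∈ N :=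
      N.mul_mem (Subgroup.Normal.conj_mem ‹_› g hg t) (N.inv_mem hg)
    have h0 := eq_zero_of_mem_of_smul_eq_add N hΓ hmem (c := a + a) fun w => by
      rw [mul_smul, mul_smul, mul_smul, hginv, htinv, hc, ht]; abel
    exact ha (eq_zero_of_add_self_eq_zero h0)

/-- If `Γ/N` is infinite cyclic and `Γ/NK` is finite, then `V^⊥` is a line on which `Γ` acts by
translations through the infinite cyclic group `Γ/N`. -/
theorem exists_hom_int_perpAction_eq (hΓ : IsSpaceGroup Γ) (hcyc : IsCyclic (Γ ⧸ N))
    (hinf : Infinite (Γ ⧸ N)) (hfin : Finite (StructureGroup N)) :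
    ∃ χ : Γ →* Multiplicative ℤ, Function.Surjective χ ∧ χ.ker = N ∧
      ∃ c : ((spanOf N)ᗮ : Submodule ℝ (EucSpace n)), c ≠ 0 ∧
        (∀ w : ((spanOf N)ᗮ : Submodule ℝ (EucSpace n)), ∃ x : ℝ, w = x • c) ∧
        ∀ (g : Γ) (w : ((spanOf N)ᗮ : Submodule ℝ (EucSpace n))),
          g • w = w + (χ g).toAdd • c := by
  obtain ⟨χ, hsurj, hker⟩ := exists_surjective_hom_int N hcyc hinf
  obtain ⟨t, htlin, ht0⟩ := exists_translation_not_mem_spanOf N hΓ hinf hfin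
  have hline := exists_eq_smul_of_spanOf_sup N (spanOf_sup_span_singleton N hΓ hker htlin ht0)
  have hta := perpAction_eq_of_linPart_eq_one N htlin
  set a := (spanOf N)ᗮ.orthogonalProjectionOnto ((t : EucIsom n) 0) with ha_def
  have ha : a ≠ 0 := by
    rw [ha_def, Ne, Submodule.orthogonalProjectionOnto_eq_zero_iff,
      Submodule.orthogonal_orthogonal]
    exact ht0
  obtain ⟨d, hd⟩ := hsurj (Multiplicative.ofAdd 1)
  have hdpow : ∀ (g : Γ) (w : ((spanOf N)ᗮ : Submodule ℝ (EucSpace n))),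
      g • w = (d ^ (χ g).toAdd) • w := fun g w => by
    have hmem : (d ^ (χ g).toAdd)⁻¹ * g ∈ N := by
      rw [← hker, MonoidHom.mem_ker, map_mul, map_inv, map_zpow, hd, inv_mul_eq_one,
        ← ofAdd_zsmul, smul_eq_mul, mul_one, ofAdd_toAdd]
    have h1 := smul_eq_self_of_mem N hΓ ha hline hta hmem w
    rwa [mul_smul, inv_smul_eq_iff] at h1
  refine ⟨χ, hsurj, hker, ?_⟩
  obtain ⟨c, hc | hc⟩ := perpAction_eq_add_or_eq_neg_add N ha hline d
  · have hact : ∀ (g : Γ) (w : ((spanOf N)ᗮ : Submodule ℝ (EucSpace n))),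
        g • w = w + (χ g).toAdd • c := fun g w => by rw [hdpow, zpow_smul_eq_add hc]
    have hc0 : c ≠ 0 := by
      rintro rfl
      have h1 := hta 0
      rw [hact, smul_zero] at h1
      exact ha (add_left_cancel h1).symm
    refine ⟨c, hc0, fun w => ?_, hact⟩
    obtain ⟨x, rfl⟩ := hline w
    obtain ⟨y, hy⟩ := hline c
    have hy0 : y ≠ 0 := by
      rintro rfl
      exact hc0 (hy.trans (zero_smul _ _))
    refine ⟨x * y⁻¹, ?_⟩
    rw [hy, smul_smul, inv_mul_cancel_right₀ hy0]
  -- If `d` reflects, `d ^ 2` acts trivially; `t ^ 2` has even degree, so it would too, although it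
  -- translates by `2a`.
  · exfalso
    have hd2 : ∀ w : ((spanOf N)ᗮ : Submodule ℝ (EucSpace n)), (d ^ (2 : ℤ)) • w = w + 0 :=
      fun w => by rw [zpow_two, mul_smul, hc, hc]; abel
    have h1 := hta (t • 0)
    rw [← mul_smul, hdpow, map_mul, toAdd_mul, ← two_mul, zpow_mul, zpow_smul_eq_add hd2, hta,
      smul_zero, zero_add, zero_add] at h1
    exact ha (eq_zero_of_add_self_eq_zero h1.symm)

end PerpLine

/-! ### Norms and multiples of angles. -/

namespace Real.Angle

theorem norm_coe_eq (θ : ℝ) :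
    ‖(θ : Angle)‖ = |θ - round ((2 * π)⁻¹ * θ) * (2 * π)| := AddCircle.norm_eq _

theorem norm_coe_le_abs (θ : ℝ) : ‖(θ : Angle)‖ ≤ |θ| := QuotientAddGroup.norm_mk_le_norm

theorem norm_le_pi (θ : Angle) : ‖θ‖ ≤ π := by
  have h := AddCircle.norm_le_half_period (2 * π) (x := θ) (by positivity)
  rw [abs_of_pos (by positivity)] at h
  change ‖θ‖ ≤ _ at h
  linarith

theorem norm_coe_pi : ‖(π : Angle)‖ = π := by
  have h := AddCircle.norm_half_period_eq (2 * π)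
  rw [abs_of_pos (by positivity), mul_div_cancel_left₀ _ two_ne_zero] at h
  exact h

theorem eq_or_eq_neg_of_norm_eq {a b : Angle} (h : ‖a‖ = ‖b‖) : a = b ∨ a = -b := by
  induction a using Real.Angle.induction_on with | _ x
  induction b using Real.Angle.induction_on with | _ y
  rw [norm_coe_eq, norm_coe_eq, abs_eq_abs] at h
  rw [← coe_neg, angle_eq_iff_two_pi_dvd_sub, angle_eq_iff_two_pi_dvd_sub]
  refine h.imp (fun h => ⟨round ((2 * π)⁻¹ * x) - round ((2 * π)⁻¹ * y), ?_⟩)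
    (fun h => ⟨round ((2 * π)⁻¹ * x) + round ((2 * π)⁻¹ * y), ?_⟩)
  all_goals
    push_cast
    linear_combination h

theorem zsmul_two_pi_div_eq_zero_iff {m : ℕ} (hm : 0 < m) (j : ℤ) :
    j • ((2 * π / m : ℝ) : Angle) = 0 ↔ (m : ℤ) ∣ j := by
  have hm' : (m : ℝ) ≠ 0 := by positivity
  rw [← coe_zsmul, ← coe_zero, angle_eq_iff_two_pi_dvd_sub]
  refine exists_congr fun k => ?_
  have h1 : j • (2 * π / m) - 0 = 2 * π * (j / m) := by
    rw [zsmul_eq_mul]; ring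
  rw [h1, mul_right_inj' (by positivity), div_eq_iff hm', mul_comm]
  exact_mod_cast Iff.rfl

end Real.Angle

theorem Int.mem_addSubgroup_iff_index_dvd (S : AddSubgroup ℤ) (a : ℤ) :
    a ∈ S ↔ (S.index : ℤ) ∣ a := by
  obtain ⟨k, rfl⟩ := Int.subgroup_cyclic S
  rw [← AddSubgroup.zmultiples_eq_closure, Int.index_zmultiples, Int.natAbs_dvd,
    Int.mem_zmultiples_iff]

/-! ### The circle `V^⊥/K` and the rotations of it by `Γ/NK`. -/

section Circle

variable {n : ℕ} {Γ : Subgroup (EucIsom n)} (N : Subgroup Γ) [N.Normal]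

section Degree

variable {N} {χ : Γ →* Multiplicative ℤ}

theorem sup_kernelOf_eq_comap (hker : χ.ker = N) :
    N ⊔ kernelOf N = ((kernelOf N).map χ).comap χ := by
  rw [Subgroup.comap_map_eq, hker, sup_comm]

/-- `NK` is the preimage of `χ(K)`, so `χ(K)` has index `|Γ/NK|` in `ℤ`, and a subgroup of `ℤ`
consists of the multiples of its index. -/
theorem mem_sup_kernelOf_iff (hsurj : Function.Surjective χ) (hker : χ.ker = N) (g : Γ) :
    g ∈ N ⊔ kernelOf N ↔ (Nat.card (StructureGroup N) : ℤ) ∣ (χ g).toAdd := by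
  have h1 := sup_kernelOf_eq_comap hker
  have h2 : Nat.card (StructureGroup N) = ((kernelOf N).map χ).index := by
    rw [← Subgroup.index_comap_of_surjective _ hsurj, ← h1]
    rfl
  rw [h2, h1, Subgroup.mem_comap]
  exact Int.mem_addSubgroup_iff_index_dvd (Subgroup.toAddSubgroup' ((kernelOf N).map χ)) _

theorem exists_mem_kernelOf_iff (hsurj : Function.Surjective χ) (hker : χ.ker = N) (j : ℤ) :
    (∃ k ∈ kernelOf N, (χ k).toAdd = j) ↔ (Nat.card (StructureGroup N) : ℤ) ∣ j := by
  obtain ⟨g, hg⟩ := hsurj (Multiplicative.ofAdd j)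
  have h1 := mem_sup_kernelOf_iff hsurj hker g
  rw [hg, toAdd_ofAdd] at h1
  rw [← h1, sup_kernelOf_eq_comap hker, Subgroup.mem_comap, hg]
  rfl

theorem zpowers_mk_eq_top_iff (hsurj : Function.Surjective χ) (hker : χ.ker = N) (g : Γ) :
    Subgroup.zpowers (QuotientGroup.mk g : Γ ⧸ N) = ⊤ ↔
      (χ g).toAdd = 1 ∨ (χ g).toAdd = -1 := by
  have hmk : ∀ (j : ℤ) (d : Γ), (QuotientGroup.mk g : Γ ⧸ N) ^ j = QuotientGroup.mk d ↔
      j * (χ g).toAdd = (χ d).toAdd := fun j d => by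
    rw [← QuotientGroup.mk_zpow, QuotientGroup.eq, ← hker, MonoidHom.mem_ker, map_mul, map_inv,
      map_zpow, inv_mul_eq_one, ← Multiplicative.toAdd.injective.eq_iff, toAdd_zpow, smul_eq_mul]
  rw [← Int.isUnit_iff]
  constructor
  · intro h
    obtain ⟨d, hd⟩ := hsurj (Multiplicative.ofAdd 1)
    obtain ⟨j, hj⟩ := (Subgroup.eq_top_iff' _).1 h (QuotientGroup.mk d)
    have h1 := (hmk j d).1 hj
    rw [hd, toAdd_ofAdd] at h1
    exact IsUnit.of_mul_eq_one_right j h1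
  · intro h
    refine (Subgroup.eq_top_iff' _).2 fun x => ?_
    obtain ⟨d, rfl⟩ := QuotientGroup.mk_surjective x
    refine ⟨(χ d).toAdd * (χ g).toAdd, (hmk _ d).2 ?_⟩
    rw [mul_assoc, Int.isUnit_mul_self h, mul_one]

end Degree

theorem perpOrbit_eq_iff (w w' : ((spanOf N)ᗮ : Submodule ℝ (EucSpace n))) :
    perpOrbit N w = perpOrbit N w' ↔ ∃ k ∈ kernelOf N, k • w' = w := by
  refine Quotient.eq.trans ?_
  rw [MulAction.orbitRel_apply]
  exact ⟨fun ⟨k, hk⟩ => ⟨k, k.2, hk⟩, fun ⟨k, hk, h⟩ => ⟨⟨k, hk⟩, h⟩⟩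

/-- Compare diameters: the points at angles `π` and `0` under `φ` are `a π` apart, while under `ψ`
no distance exceeds `b π`. -/
theorem IsAngularCoordinate.scale_le {φ ψ : PerpOrbitSpace N ≃ Real.Angle} {a b : ℝ} (hb : 0 < b)
    (hφ : ∀ p q, perpOrbitDist N p q = a * dist (φ p) (φ q))
    (hψ : ∀ p q, perpOrbitDist N p q = b * dist (ψ p) (ψ q)) : a ≤ b := by
  have h1 := hφ (φ.symm (Real.pi : Real.Angle)) (φ.symm 0)
  rw [hψ, Equiv.apply_symm_apply, Equiv.apply_symm_apply, dist_zero_right,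
    Real.Angle.norm_coe_pi, dist_eq_norm] at h1
  refine le_of_mul_le_mul_right ?_ Real.pi_pos
  rw [← h1]
  exact mul_le_mul_of_nonneg_left (Real.Angle.norm_le_pi _) hb.le

/-- The rotation angle of a rotation of `V^⊥/K` is determined up to sign. -/
theorem IsRotationBy.norm_eq {f : PerpOrbitSpace N → PerpOrbitSpace N} {θ : ℝ}
    (hf : IsRotationBy N f θ) {φ : PerpOrbitSpace N ≃ Real.Angle} (hφ : IsAngularCoordinate N φ)
    {α : Real.Angle} (hα : ∀ p, φ (f p) = φ p + α) : ‖α‖ = ‖(θ : Real.Angle)‖ := by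
  obtain ⟨ψ, ⟨b, hb, hψ⟩, hθ⟩ := hf
  obtain ⟨a, ha, hφ⟩ := hφ
  have hab : a = b := le_antisymm (IsAngularCoordinate.scale_le N hb hφ hψ)
    (IsAngularCoordinate.scale_le N ha hψ hφ)
  have h1 := hφ (f (φ.symm 0)) (φ.symm 0)
  rw [hψ, hα, hθ, dist_eq_norm, dist_eq_norm, add_sub_cancel_left, add_sub_cancel_left, hab] at h1
  exact (mul_left_cancel₀ hb.ne' h1).symm

theorem perpOrbitDist_eq {m : ℕ} (hm : 0 < m)
    {x : ((spanOf N)ᗮ : Submodule ℝ (EucSpace n)) → ℝ} {C : ℝ}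
    (hdist : ∀ w w', dist w w' = |x w - x w'| * C) (hsurj : Function.Surjective x)
    (horbit : ∀ w w', perpOrbit N w = perpOrbit N w' ↔ ∃ j : ℤ, x w = x w' + m * j)
    (w w' : ((spanOf N)ᗮ : Submodule ℝ (EucSpace n))) :
    perpOrbitDist N (perpOrbit N w) (perpOrbit N w')
      = m / (2 * Real.pi) * C * ‖(((x w - x w') * (2 * Real.pi / m) : ℝ) : Real.Angle)‖ := by
  have hm' : (0 : ℝ) < m := by exact_mod_cast hm
  have hπ := Real.pi_pos
  obtain ⟨v₀, hv₀⟩ := hsurj 0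
  obtain ⟨v₁, hv₁⟩ := hsurj 1
  have hC : 0 ≤ C := by
    have h := hdist v₁ v₀
    rw [hv₀, hv₁, sub_zero, abs_one, one_mul] at h
    exact h ▸ dist_nonneg
  have hnorm : ∀ y : ℝ, |y| * C = m / (2 * Real.pi) * C * |y * (2 * Real.pi / m)| := fun y => by
    rw [abs_mul, abs_of_pos (show 0 < 2 * Real.pi / m by positivity)]
    field_simp
  refine IsLeast.csInf_eq ⟨?_, ?_⟩
  · rw [Real.Angle.norm_coe_eq]
    -- The multiple of `m` that brings the second representative closest to `w`; it attains the
    -- infimum.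
    set r := round ((2 * Real.pi)⁻¹ * ((x w - x w') * (2 * Real.pi / m)))
    obtain ⟨v, hv⟩ := hsurj (x w' + m * r)
    refine ⟨w, v, rfl, (horbit _ _).2 ⟨r, hv⟩, ?_⟩
    rw [hdist, hv, hnorm]
    congr 2
    field_simp
    ring
  · rintro d ⟨v, v', hv, hv', rfl⟩
    obtain ⟨j, hj⟩ := (horbit _ _).1 hv
    obtain ⟨j', hj'⟩ := (horbit _ _).1 hv'
    have h1 : (((x w - x w') * (2 * Real.pi / m) : ℝ) : Real.Angle)
        = (((x v - x v') * (2 * Real.pi / m) : ℝ) : Real.Angle) := by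
      rw [Real.Angle.angle_eq_iff_two_pi_dvd_sub]
      refine ⟨j' - j, ?_⟩
      rw [hj, hj']
      push_cast
      field_simp
      ring
    rw [h1, hdist, hnorm]
    exact mul_le_mul_of_nonneg_left (Real.Angle.norm_coe_le_abs _) (by positivity)

/-- If `Γ` acts on the line `V^⊥` by translations through `χ`, then `V^⊥/K` is a circle on which
`g` acts by rotation through `χ g` times `2π/m`. -/
theorem exists_angularCoordinate {χ : Γ →* Multiplicative ℤ} (hsurj : Function.Surjective χ)
    (hker : χ.ker = N) (hfin : Finite (StructureGroup N))
    {c : ((spanOf N)ᗮ : Submodule ℝ (EucSpace n))} (hc : c ≠ 0)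
    (hline : ∀ w : ((spanOf N)ᗮ : Submodule ℝ (EucSpace n)), ∃ x : ℝ, w = x • c)
    (hact : ∀ (g : Γ) (w : ((spanOf N)ᗮ : Submodule ℝ (EucSpace n))),
      g • w = w + (χ g).toAdd • c) :
    ∃ φ : PerpOrbitSpace N ≃ Real.Angle, IsAngularCoordinate N φ ∧
      ∀ (g : Γ) (w : ((spanOf N)ᗮ : Submodule ℝ (EucSpace n))),
        φ (perpOrbit N (g • w)) = φ (perpOrbit N w) +
          (χ g).toAdd • ((2 * Real.pi / Nat.card (StructureGroup N) : ℝ) : Real.Angle) := by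
  set m := Nat.card (StructureGroup N) with hm
  have hm0 : 0 < m := Nat.card_pos
  have hm0' : (0 : ℝ) < m := by exact_mod_cast hm0
  have hπ := Real.pi_pos
  choose x hx using hline
  have hx_smul : ∀ y : ℝ, x (y • c) = y := fun y =>
    (smul_left_injective ℝ hc (hx (y • c))).symm
  have hx_add : ∀ (w : ((spanOf N)ᗮ : Submodule ℝ (EucSpace n))) (j : ℤ),
      x (w + j • c) = x w + j := fun w j => by
    conv_lhs => rw [hx w, ← Int.cast_smul_eq_zsmul ℝ j, ← add_smul]
    exact hx_smul _
  have horbit : ∀ w w' : ((spanOf N)ᗮ : Submodule ℝ (EucSpace n)),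
      perpOrbit N w = perpOrbit N w' ↔ ∃ j : ℤ, x w = x w' + m * j := fun w w' => by
    rw [perpOrbit_eq_iff]
    constructor
    · rintro ⟨k, hk, rfl⟩
      obtain ⟨j, hj⟩ := (exists_mem_kernelOf_iff hsurj hker _).1 ⟨k, hk, rfl⟩
      refine ⟨j, ?_⟩
      rw [hact, hx_add, hj]
      push_cast
      rfl
    · rintro ⟨j, hj⟩
      obtain ⟨k, hk, hkj⟩ := (exists_mem_kernelOf_iff hsurj hker (m * j)).2 (dvd_mul_right _ _)
      refine ⟨k, hk, ?_⟩
      rw [hact, hkj, hx w, hj, add_smul, ← hx w', ← Int.cast_smul_eq_zsmul ℝ]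
      push_cast
      rfl
  -- The factor `2π/m` turns the period `m` of `K` on the line into `2π`.
  let f : ((spanOf N)ᗮ : Submodule ℝ (EucSpace n)) → Real.Angle :=
    fun w => ((x w * (2 * Real.pi / m) : ℝ) : Real.Angle)
  have hf : ∀ w w', f w = f w' ↔ perpOrbit N w = perpOrbit N w' := fun w w' => by
    rw [horbit, Real.Angle.angle_eq_iff_two_pi_dvd_sub]
    refine exists_congr fun j => ?_
    have h1 : x w * (2 * Real.pi / m) - x w' * (2 * Real.pi / m)
        = 2 * Real.pi * ((x w - x w') / m) := by ring
    rw [h1, mul_right_inj' (by positivity), div_eq_iff hm0'.ne', sub_eq_iff_eq_add', mul_comm]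
  let F : PerpOrbitSpace N → Real.Angle := Quotient.lift f fun w w' h =>
    (hf w w').2 (Quotient.sound h)
  have hF : ∀ w, F (perpOrbit N w) = f w := fun _ => rfl
  have hFbij : Function.Bijective F := by
    constructor
    · intro p q
      obtain ⟨w, rfl⟩ := Quotient.exists_rep p
      obtain ⟨w', rfl⟩ := Quotient.exists_rep q
      exact (hf w w').1
    · intro θ
      induction θ using Real.Angle.induction_on with | _ y
      refine ⟨perpOrbit N ((y / (2 * Real.pi / m)) • c), ?_⟩
      rw [hF]
      change ((_ : ℝ) : Real.Angle) = _
      rw [hx_smul, div_mul_cancel₀ _ (by positivity)]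
  have hdist : ∀ w w', dist w w' = |x w - x w'| * ‖c‖ := fun w w' => by
    conv_lhs => rw [hx w, hx w', dist_eq_norm, ← sub_smul, norm_smul, Real.norm_eq_abs]
  refine ⟨Equiv.ofBijective F hFbij, ⟨m / (2 * Real.pi) * ‖c‖, by positivity, fun p q => ?_⟩,
    fun g w => ?_⟩
  · obtain ⟨w, rfl⟩ := Quotient.exists_rep p
    obtain ⟨w', rfl⟩ := Quotient.exists_rep q
    change perpOrbitDist N (perpOrbit N w) (perpOrbit N w') = _ * dist (f w) (f w')
    rw [perpOrbitDist_eq N hm0 hdist (fun y => ⟨y • c, hx_smul y⟩) horbit, dist_eq_norm,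
      ← Real.Angle.coe_sub, ← sub_mul]
  · change f (g • w) = f w + _
    change ((_ : ℝ) : Real.Angle) = ((_ : ℝ) : Real.Angle) + _
    rw [hact, hx_add, ← Real.Angle.coe_zsmul, ← Real.Angle.coe_add, add_mul, zsmul_eq_mul]

/-- The action of the structure group on `V^⊥/K`, in terms of an angular coordinate. -/
theorem exists_structureAction {χ : Γ →* Multiplicative ℤ} (hsurj : Function.Surjective χ)
    (hker : χ.ker = N) (hfin : Finite (StructureGroup N)) (φ : PerpOrbitSpace N ≃ Real.Angle)
    (hφ : ∀ (g : Γ) (w : ((spanOf N)ᗮ : Submodule ℝ (EucSpace n))),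
      φ (perpOrbit N (g • w)) = φ (perpOrbit N w) +
        (χ g).toAdd • ((2 * Real.pi / Nat.card (StructureGroup N) : ℝ) : Real.Angle)) :
    ∃ ρ : StructureGroup N →* Equiv.Perm (PerpOrbitSpace N), IsStructureAction N ρ ∧
      ∀ (g : Γ) (p : PerpOrbitSpace N), φ (ρ (QuotientGroup.mk g) p) = φ p +
        (χ g).toAdd • ((2 * Real.pi / Nat.card (StructureGroup N) : ℝ) : Real.Angle) := by
  set α : Real.Angle := ((2 * Real.pi / Nat.card (StructureGroup N) : ℝ) : Real.Angle) with hα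
  -- Defined as a rotation in the coordinate `φ`, so that multiplicativity is additivity of angles;
  -- `hφ` identifies it with the geometric action.
  let r : Γ → Equiv.Perm (PerpOrbitSpace N) := fun g =>
    (φ.trans (Equiv.addRight ((χ g).toAdd • α))).trans φ.symm
  have hr : ∀ (g : Γ) (p : PerpOrbitSpace N), φ (r g p) = φ p + (χ g).toAdd • α :=
    fun g p => φ.apply_symm_apply _
  let R : Γ →* Equiv.Perm (PerpOrbitSpace N) := MonoidHom.mk' r fun g h =>
    Equiv.ext fun p => φ.injective <| by
      rw [Equiv.Perm.mul_apply, hr, hr, hr, map_mul, toAdd_mul, add_smul, add_assoc,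
        add_comm ((χ g).toAdd • α)]
  have hR : ∀ (g : Γ) (p : PerpOrbitSpace N), φ (R g p) = φ p + (χ g).toAdd • α := hr
  let ρ : StructureGroup N →* Equiv.Perm (PerpOrbitSpace N) :=
    QuotientGroup.lift (N ⊔ kernelOf N) R fun g hg => by
      ext p
      apply φ.injective
      rw [hR, (Real.Angle.zsmul_two_pi_div_eq_zero_iff Nat.card_pos _).2
        ((mem_sup_kernelOf_iff hsurj hker g).1 hg), add_zero]
      rfl
  have hρ : ∀ (g : Γ) (p : PerpOrbitSpace N),
      φ (ρ (QuotientGroup.mk g) p) = φ p + (χ g).toAdd • α := hR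
  exact ⟨ρ, fun g w => φ.injective (by rw [hρ, hφ]), hρ⟩

end Circle

theorem theorem11 (n : ℕ) (Γ : Subgroup (EucIsom n)) (hΓ : IsSpaceGroup Γ)
    (N : Subgroup Γ) [N.Normal] (hcyc : IsCyclic (Γ ⧸ N)) (hinf : Infinite (Γ ⧸ N))
    (m : ℕ) (hfin : Finite (StructureGroup N)) (hm : Nat.card (StructureGroup N) = m) :
    PerpOrbitSpaceIsCircle N ∧
    ∃ ρ : StructureGroup N →* Equiv.Perm (PerpOrbitSpace N), IsStructureAction N ρ ∧
      ∀ γ : Γ, Subgroup.zpowers (QuotientGroup.mk γ : StructureGroup N) = ⊤ →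
        ((∃ δ : Γ, (QuotientGroup.mk γ : StructureGroup N) = QuotientGroup.mk δ ∧
            Subgroup.zpowers (QuotientGroup.mk δ : Γ ⧸ N) = ⊤) ↔
          (IsRotationBy N (ρ (QuotientGroup.mk γ)) (2 * Real.pi / m) ∨
            IsRotationBy N (ρ (QuotientGroup.mk γ)) (-(2 * Real.pi / m)))) := by
  obtain ⟨χ, hsurj, hker, c, hc, hline, hact⟩ :=
    exists_hom_int_perpAction_eq N hΓ hcyc hinf hfin
  obtain ⟨φ, hφang, hφ⟩ := exists_angularCoordinate N hsurj hker hfin hc hline hact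
  obtain ⟨ρ, hρact, hρ⟩ := exists_structureAction N hsurj hker hfin φ hφ
  have hm0 : 0 < m := hm ▸ Nat.card_pos
  rw [hm] at hρ
  refine ⟨⟨φ, hφang⟩, ρ, hρact, fun γ _ => ⟨?_, fun hrot => ?_⟩⟩
  · rintro ⟨δ, hγδ, hδ⟩
    rw [hγδ]
    refine ((zpowers_mk_eq_top_iff hsurj hker δ).1 hδ).imp (fun h => ⟨φ, hφang, fun p => ?_⟩)
      (fun h => ⟨φ, hφang, fun p => ?_⟩)
    · rw [hρ, h, one_smul]
    · rw [hρ, h, neg_smul, one_smul, Real.Angle.coe_neg]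
  · have hnorm : ‖(χ γ).toAdd • ((2 * Real.pi / m : ℝ) : Real.Angle)‖
        = ‖((2 * Real.pi / m : ℝ) : Real.Angle)‖ := by
      rcases hrot with h | h
      · exact h.norm_eq N hφang (hρ γ)
      · rw [h.norm_eq N hφang (hρ γ), Real.Angle.coe_neg, norm_neg]
    -- Angles of equal norm agree up to sign, so `χ(γ) ≡ ±1` mod `m`; any `δ` of degree `e` then
    -- works.
    obtain ⟨e, he, hdvd⟩ : ∃ e : ℤ, (e = 1 ∨ e = -1) ∧ (m : ℤ) ∣ -(χ γ).toAdd + e := by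
      rcases Real.Angle.eq_or_eq_neg_of_norm_eq hnorm with h | h
      · refine ⟨1, Or.inl rfl, (Real.Angle.zsmul_two_pi_div_eq_zero_iff hm0 _).1 ?_⟩
        rw [add_smul, neg_smul, h, one_smul, neg_add_cancel]
      · refine ⟨-1, Or.inr rfl, (Real.Angle.zsmul_two_pi_div_eq_zero_iff hm0 _).1 ?_⟩
        rw [add_smul, neg_smul, h, neg_smul, one_smul, neg_neg, add_neg_cancel]
    obtain ⟨δ, hδ⟩ := hsurj (Multiplicative.ofAdd e)
    refine ⟨δ, ?_, (zpowers_mk_eq_top_iff hsurj hker δ).2 (by rwa [hδ, toAdd_ofAdd])⟩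
    rw [QuotientGroup.eq, mem_sup_kernelOf_iff hsurj hker, hm, map_mul, map_inv, toAdd_mul,
      toAdd_inv, hδ, toAdd_ofAdd]
    exact hdvd

end
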